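/- Let $q$ be a prime power, let $n\ge 6$, and let $V$ be an $n$-dimensional vector space over the field $\mathbb F_q$ with $q$ elements. Write ${n\brack k}_q=\prod_{i=0}^{k-1}\frac{q^{n-i}-1}{q^{k-i}-1}$ for the Gaussian binomial coefficient. For a family $\mathcal G$ of $3$-dimensional subspaces of $V$, let $\mathcal I(\mathcal G)=\sum_{A\in\mathcal G}\sum_{B\in\mathcal G}\dim(A\cap B)$ be its total intersection number, and for such a family $\mathcal F$ let $\mathcal{MI}(\mathcal F)$ be the maximum of $\mathcal I(\mathcal G)$ over all families $\mathcal G$ of $3$-dimensional subspaces of $V$ with $|\mathcal G|=|\mathcal F|$. Let $\mathcal F$ be a family of $3$-dimensional subspaces of $V$ with $|\mathcal F|={n-2\brack 1}_q$. Then $$\mathcal{MI}(\mathcal F)=\frac{(2q^{n-2}+q-3)(q^{n-2}-1)}{(q-1)^2}.$$ Moreover, the maximum is attained by every full $2$-star: for every $2$-dimensional subspace $U$ of $V$, the family $\mathcal Y_U$ of all $3$-dimensional subspaces of $V$ containing $U$ satisfies $|\mathcal Y_U|=|\mathcal F|$ and $\mathcal I(\mathcal Y_U)=\mathcal{MI}(\mathcal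 F)$. Consequently the second linear programming bound $$\mathcal{MI}(\mathcal F)\le\left[\frac{{n\brack k}_q}{M}-\frac{(q^n-1)(q^{n-1}-1)}{(q-1)(q^k-1)}\right]\frac{M^2(q^k-1)(q^{k-1}-1)(q^{n-k}-1)}{(q^n-1)(q^{n-1}-1)(q^{n-2}-1)}+kM^2,$$ which is stated for families of $M$ subspaces of dimension $k$ with $n\ge 2k$ and $M\le{n-1\brack k-1}_q$, is tight: for $k=3$ and $M=|\mathcal F|={n-2\brack 1}_q$ one has $M\le{n-1\brack 2}_q$, and equality holds in the bound. -/

import Mathlib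

/-- The set of all `k`-dimensional subspaces of the `K`-vector space `V`. -/
def Grass (K V : Type*) [Field K] [AddCommGroup V] [Module K V] (k : ℕ) : Type _ :=
  {W : Submodule K V // Module.finrank K W = k}

/-- A finite-dimensional space over a finite field has finitely many `k`-dimensional subspaces. -/
noncomputable instance Grass.instFintype (K V : Type*) [Field K] [Finite K] [AddCommGroup V]
    [Module K V] [FiniteDimensional K V] (k : ℕ) : Fintype (Grass K V k) :=
  haveI : Finite V := Module.finite_of_finite K
  haveI : Finite (Grass K V k) := Subtype.finite
  Fintype.ofFinite _

/-- The Gaussian binomial coefficient `∏_{i < k} (q ^ (n - i) - 1) / (q ^ (k - i) - 1)`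
(for `k ≤ n`). -/
def gaussBinom (q n k : ℕ) : ℚ :=
  ∏ i ∈ Finset.range k, ((q : ℚ) ^ (n - i) - 1) / ((q : ℚ) ^ (k - i) - 1)

/-- `int(A, B) = dim (A ∩ B)`. -/
noncomputable def interDim {K V : Type*} [Field K] [AddCommGroup V] [Module K V] {k : ℕ}
    (A B : Grass K V k) : ℕ :=
  Module.finrank K (A.1 ⊓ B.1 : Submodule K V)

/-- The total intersection number of a family `F`, the sum over ordered pairs (the pairs
`(A, A)` included). -/
noncomputable def totalInter {K V : Type*} [Field K] [AddCommGroup V] [Module K V] {k : ℕ}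
    (F : Finset (Grass K V k)) : ℕ :=
  ∑ A ∈ F, ∑ B ∈ F, interDim A B

/-- The maximum of the total intersection number over all families of `k`-dimensional subspaces
of `V` with as many members as `F`. -/
noncomputable def maxTotalInter {K V : Type*} [Field K] [Finite K] [AddCommGroup V] [Module K V]
    [FiniteDimensional K V] {k : ℕ} (F : Finset (Grass K V k)) : ℕ :=
  (Finset.univ.powersetCard F.card).sup'
    ⟨F, Finset.mem_powersetCard.2 ⟨Finset.subset_univ F, rfl⟩⟩ totalInter

open Classical in
/-- The full star at `U`: all `k`-dimensional subspaces of `V` that contain `U`. -/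
noncomputable def fullStar {K V : Type*} [Field K] [Finite K] [AddCommGroup V] [Module K V]
    [FiniteDimensional K V] (k : ℕ) (U : Submodule K V) : Finset (Grass K V k) :=
  Finset.univ.filter fun W => U ≤ W.1

/-- The second linear programming bound, on families of `M` subspaces of dimension `k`; it is
formulated for `2 * k ≤ n` and `M ≤ gaussBinom q (n - 1) (k - 1)`. -/
def secondLPBound (q n k : ℕ) (M : ℚ) : ℚ :=
  (gaussBinom q n k / M
      - ((q : ℚ) ^ n - 1) * ((q : ℚ) ^ (n - 1) - 1) / (((q : ℚ) - 1) * ((q : ℚ) ^ k - 1)))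
    * (M ^ 2 * ((q : ℚ) ^ k - 1) * ((q : ℚ) ^ (k - 1) - 1) * ((q : ℚ) ^ (n - k) - 1)
      / (((q : ℚ) ^ n - 1) * ((q : ℚ) ^ (n - 1) - 1) * ((q : ℚ) ^ (n - 2) - 1)))
    + k * M ^ 2

open Module

section

variable {K V : Type*} [Field K] [AddCommGroup V] [Module K V]

/-! Distinct 3-spaces meet in dimension at most 2, so a family of size M has total intersection at
most M(2M + 1) (`totalInter_le`). All members of a full 2-star share a plane, so a star attains this
(`totalInter_eq_of_forall_le`). Its size is the number of points of the quotient by that plane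
(`card_fullStar`), which is exactly the prescribed M. The maximum is therefore M(2M + 1), and at
this M the linear programming bound reduces to the same expression
(`secondLPBound_three_gaussBinom`). -/

theorem interDim_self {k : ℕ} (A : Grass K V k) : interDim A A = k := by
  rw [interDim, inf_idem]
  exact A.2

variable [FiniteDimensional K V]

/-- Two distinct `(k + 1)`-dimensional subspaces meet in dimension at most `k`. -/
theorem interDim_le_of_ne {k : ℕ} {A B : Grass K V (k + 1)} (h : A ≠ B) : interDim A B ≤ k := by
  by_contra! hk
  have hA : A.1 ⊓ B.1 = A.1 :=
    Submodule.eq_of_le_of_finrank_le inf_le_left (by rw [A.2]; exact hk)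
  have hB : A.1 ⊓ B.1 = B.1 :=
    Submodule.eq_of_le_of_finrank_le inf_le_right (by rw [B.2]; exact hk)
  exact h (Subtype.ext (hA.symm.trans hB))

/-- For fixed `A`, every `B` contributes at most `k`, with one extra unit on the diagonal `B = A`.
-/
theorem totalInter_le {k : ℕ} (G : Finset (Grass K V (k + 1))) :
    totalInter G ≤ G.card * (k * G.card + 1) := by
  classical
  refine Finset.sum_le_card_nsmul G _ _ fun A hA => ?_
  calc ∑ B ∈ G, interDim A B ≤ ∑ B ∈ G, (k + if A = B then 1 else 0) := by
        refine Finset.sum_le_sum fun B _ => ?_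
        split_ifs with h
        · subst h
          exact (interDim_self A).le
        · exact interDim_le_of_ne h
    _ = k * G.card + 1 := by
        simp [Finset.sum_add_distrib, hA, mul_comm]

/-- A family whose members all contain a fixed `k`-dimensional subspace attains the bound
of `totalInter_le`. -/
theorem totalInter_eq_of_forall_le {k : ℕ} {U : Submodule K V} (hU : finrank K U = k)
    {G : Finset (Grass K V (k + 1))} (hG : ∀ W ∈ G, U ≤ W.1) :
    totalInter G = G.card * (k * G.card + 1) := by
  classical
  refine Finset.sum_eq_card_nsmul fun A hA => ?_
  calc ∑ B ∈ G, interDim A B = ∑ B ∈ G, (k + if A = B then 1 else 0) := by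
        refine Finset.sum_congr rfl fun B hB => ?_
        split_ifs with h
        · subst h
          exact interDim_self A
        · refine (interDim_le_of_ne h).antisymm ?_
          exact hU.symm.le.trans (Submodule.finrank_mono (le_inf (hG A hA) (hG B hB)))
    _ = k * G.card + 1 := by
        simp [Finset.sum_add_distrib, hA, mul_comm]

theorem mem_fullStar [Finite K] {k : ℕ} {U : Submodule K V} {W : Grass K V k} :
    W ∈ fullStar k U ↔ U ≤ W.1 := by
  simp [fullStar]

/-- Rank-nullity for the quotient map restricted to the preimage of `H`: its image is `H` and its
kernel is a copy of `U`. -/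
theorem finrank_comap_mkQ (U : Submodule K V) (H : Submodule K (V ⧸ U)) :
    finrank K (H.comap U.mkQ) = finrank K H + finrank K U := by
  have h := LinearMap.finrank_range_add_finrank_ker (U.mkQ ∘ₗ (H.comap U.mkQ).subtype)
  have hU := U.le_comap_mkQ H
  rw [LinearMap.range_comp, Submodule.range_subtype,
    Submodule.map_comap_eq_of_surjective U.mkQ_surjective, LinearMap.ker_comp,
    Submodule.ker_mkQ, (Submodule.comapSubtypeEquivOfLe hU).finrank_eq] at h
  exact h.symm

theorem finrank_map_mkQ {k : ℕ} {U : Submodule K V} (hU : finrank K U = k)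
    {W : Grass K V (k + 1)} (hW : U ≤ W.1) : finrank K (W.1.map U.mkQ) = 1 := by
  have h := finrank_comap_mkQ U (W.1.map U.mkQ)
  rw [Submodule.comap_map_mkQ, sup_eq_right.2 hW, W.2, hU] at h
  lia

/-- The `(k + 1)`-dimensional subspaces containing a `k`-dimensional `U` are the points of the
projective space of `V ⧸ U`. -/
noncomputable def fullStarEquivProjectivization [Finite K] {k : ℕ} {U : Submodule K V}
    (hU : finrank K U = k) :
    fullStar (k + 1) U ≃ Projectivization K (V ⧸ U) :=
  Equiv.trans
    { toFun := fun W => ⟨W.1.1.map U.mkQ, finrank_map_mkQ hU (mem_fullStar.1 W.2)⟩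
      invFun := fun H => ⟨⟨H.1.comap U.mkQ, by rw [finrank_comap_mkQ, H.2, hU, add_comm]⟩,
        mem_fullStar.2 (U.le_comap_mkQ H.1)⟩
      left_inv := fun W => Subtype.ext <| Subtype.ext <|
        (Submodule.comap_map_mkQ U W.1.1).trans (sup_eq_right.2 (mem_fullStar.1 W.2))
      right_inv := fun H =>
        Subtype.ext (Submodule.map_comap_eq_of_surjective U.mkQ_surjective H.1) }
    (Projectivization.equivSubmodule K (V ⧸ U)).symm

theorem card_fullStar [Finite K] {k : ℕ} {U : Submodule K V} (hU : finrank K U = k) :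
    ((fullStar (k + 1) U).card : ℚ) = gaussBinom (Nat.card K) (finrank K V - k) 1 := by
  have hV : Finite (V ⧸ U) := Module.finite_of_finite K
  have hq : (1 : ℚ) < Nat.card K := mod_cast Finite.one_lt_card
  have hcard : (fullStar (k + 1) U).card = Nat.card (Projectivization K (V ⧸ U)) := by
    rw [← Nat.card_congr (fullStarEquivProjectivization hU), Nat.card_eq_fintype_card,
      Fintype.card_coe]
  have h := Projectivization.card' K (V ⧸ U)
  rw [Module.natCard_eq_pow_finrank (K := K), Submodule.finrank_quotient, hU] at h
  have h' := congrArg (Nat.cast : ℕ → ℚ) h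
  push_cast [Nat.cast_sub Finite.one_lt_card.le] at h'
  rw [hcard, gaussBinom, Finset.prod_range_one, eq_div_iff (by simpa using (sub_pos.2 hq).ne')]
  simp [h']

theorem exists_submodule_finrank_eq {k : ℕ} (hk : k ≤ finrank K V) :
    ∃ U : Submodule K V, finrank K U = k := by
  let b := finBasis K V
  refine ⟨Submodule.span K (Set.range (b ∘ Fin.castLE hk)), ?_⟩
  rw [finrank_span_eq_card (b.linearIndependent.comp _ (Fin.castLE_injective hk)),
    Fintype.card_fin]

/-- If a full star of `k`-spaces has the size of `F`, then the maximum is the trivial bound. -/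
theorem maxTotalInter_eq [Finite K] {k : ℕ} {U : Submodule K V} (hU : finrank K U = k)
    {F : Finset (Grass K V (k + 1))} (hF : (fullStar (k + 1) U).card = F.card) :
    maxTotalInter F = F.card * (k * F.card + 1) := by
  refine le_antisymm (Finset.sup'_le _ _ fun G hG => ?_) ?_
  · rw [← (Finset.mem_powersetCard.1 hG).2]
    exact totalInter_le G
  · rw [← hF, ← totalInter_eq_of_forall_le hU (G := fullStar (k + 1) U) fun _ => mem_fullStar.1]
    exact Finset.le_sup' totalInter
      (Finset.mem_powersetCard.2 ⟨Finset.subset_univ _, hF⟩)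

/-- The right side is the left side times (q^(m+1) - 1)/(q^2 - 1), which is at least 1. -/
theorem gaussBinom_one_le_gaussBinom_two {q m : ℕ} (hq : 1 < q) (hm : 2 ≤ m) :
    gaussBinom q m 1 ≤ gaussBinom q (m + 1) 2 := by
  have hq' : (1 : ℚ) < q := mod_cast hq
  have h1 : (0 : ℚ) < q - 1 := sub_pos.2 hq'
  have h2 : (0 : ℚ) < (q : ℚ) ^ 2 - 1 := sub_pos.2 (one_lt_pow₀ hq' two_ne_zero)
  have hm1 : (0 : ℚ) ≤ (q : ℚ) ^ m - 1 := sub_nonneg.2 (one_le_pow₀ hq'.le)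
  have h : (1 : ℚ) ≤ ((q : ℚ) ^ (m + 1) - 1) / ((q : ℚ) ^ 2 - 1) := by
    rw [one_le_div h2]
    exact sub_le_sub_right (pow_le_pow_right₀ hq'.le (by lia)) 1
  simp only [gaussBinom, Finset.prod_range_succ, Finset.prod_range_zero, one_mul, Nat.sub_zero,
    Nat.add_sub_cancel, pow_one, show 2 - 1 = 1 from rfl]
  exact le_mul_of_one_le_left (div_nonneg hm1 h1.le) h

theorem secondLPBound_three_gaussBinom {q m : ℕ} (hq : 1 < q) (hm : 2 ≤ m) :
    secondLPBound q (m + 2) 3 (gaussBinom q m 1) =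
      gaussBinom q m 1 * (2 * gaussBinom q m 1 + 1) := by
  have hq' : (1 : ℚ) < q := mod_cast hq
  have hpow : ∀ j : ℕ, j ≠ 0 → (q : ℚ) ^ j - 1 ≠ 0 := fun j hj =>
    (sub_pos.2 (one_lt_pow₀ hq' hj)).ne'
  -- The smallest exponent that occurs is n - 3 = m - 1; naming it `l` removes every truncated
  -- subtraction.
  obtain ⟨l, rfl⟩ : ∃ l, m = l + 1 := ⟨m - 1, by lia⟩
  have h1 : (q : ℚ) - 1 ≠ 0 := by simpa using hpow 1 one_ne_zero
  have h2 := hpow 2 two_ne_zero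
  have h3 := hpow 3 three_ne_zero
  have hl1 := hpow (l + 1) (by lia)
  have hl2 := hpow (l + 2) (by lia)
  have hl3 := hpow (l + 3) (by lia)
  simp only [secondLPBound, gaussBinom, Finset.prod_range_succ, Finset.prod_range_zero, one_mul,
    Nat.sub_zero, pow_one, show l + 1 + 2 = l + 3 from rfl, show l + 3 - 1 = l + 2 from rfl,
    show l + 3 - 2 = l + 1 from rfl, show l + 3 - 3 = l from rfl, show 3 - 1 = 2 from rfl,
    show 3 - 2 = 1 from rfl]
  push_cast
  field_simp
  ring

end

theorem mainTheorem7 {K V : Type*} [Field K] [Finite K] [AddCommGroup V] [Module K V]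
    [FiniteDimensional K V] (q n : ℕ) (hq : Nat.card K = q) (hV : Module.finrank K V = n)
    (hn : 6 ≤ n) (F : Finset (Grass K V 3)) (hF : (F.card : ℚ) = gaussBinom q (n - 2) 1) :
    -- the value of the maximum
    (maxTotalInter F : ℚ)
        = (2 * (q : ℚ) ^ (n - 2) + q - 3) * ((q : ℚ) ^ (n - 2) - 1) / ((q : ℚ) - 1) ^ 2 ∧
    -- every full 2-star is a family of the same size that attains it
    (∀ U : Submodule K V, Module.finrank K U = 2 →
      (fullStar 3 U).card = F.card ∧ totalInter (fullStar 3 U) = maxTotalInter F) ∧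
    -- the second linear programming bound applies to `F` and holds with equality
    (F.card : ℚ) ≤ gaussBinom q (n - 1) 2 ∧
    (maxTotalInter F : ℚ) = secondLPBound q n 3 F.card := by
  subst hq
  have hq1 : 1 < Nat.card K := Finite.one_lt_card
  have hq' : (Nat.card K : ℚ) - 1 ≠ 0 := (sub_pos.2 (Nat.one_lt_cast.2 hq1)).ne'
  have hstar : ∀ U : Submodule K V, finrank K U = 2 → (fullStar 3 U).card = F.card := by
    intro U hU
    have h := card_fullStar hU
    rw [hV, ← hF] at h
    exact_mod_cast h
  -- One star must exist for the upper bound to be attained.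
  obtain ⟨U₀, hU₀⟩ := exists_submodule_finrank_eq (K := K) (V := V) (k := 2) (by lia)
  have hmax := maxTotalInter_eq hU₀ (hstar U₀ hU₀)
  have hmax' : (maxTotalInter F : ℚ) = F.card * (2 * F.card + 1) := by
    rw [hmax]
    push_cast
    rfl
  obtain ⟨m, rfl⟩ : ∃ m, n = m + 2 := ⟨n - 2, by lia⟩
  rw [Nat.add_sub_cancel] at hF
  refine ⟨?_, fun U hU => ⟨hstar U hU, ?_⟩, ?_, ?_⟩
  · rw [hmax', hF]
    simp only [gaussBinom, Finset.prod_range_one, Nat.sub_zero, pow_one, Nat.add_sub_cancel]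
    field_simp
    ring
  · rw [hmax, ← hstar U hU]
    exact totalInter_eq_of_forall_le hU fun _ => mem_fullStar.1
  · rw [hF]
    exact gaussBinom_one_le_gaussBinom_two hq1 (by lia)
  · rw [hmax', hF, secondLPBound_three_gaussBinom hq1 (by lia)]
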